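/- Let $\mathcal X$ be a non-empty separable metrizable topological space with its Borel $\sigma$-algebra, and let $(\mathcal Y,\ell)$ be a non-empty bounded separable metric space with its Borel $\sigma$-algebra. An \emph{online learning rule} is a probability space $(R,\rho)$ (the internal randomness) together with jointly measurable functions $f_t : R\times\mathcal X^{t-1}\times\mathcal Y^{t-1}\times\mathcal X\to\mathcal Y$, $t=1,2,\dots$; that is, a possibly randomized sequence of predictors $f_t:\mathcal X^{t-1}\times\mathcal Y^{t-1}\times\mathcal X\to\mathcal Y$ whose internal randomness $r\sim\rho$ is independent of the data. There is an online learning rule $(f_t)_{t\ge 1}$ that is strongly universally consistent for the set of all processes $(\mathbb X,\mathbb Y)$ such that $\mathbb X$ is stationary. That is, there is a single online learning rule such that, for every stochastic process $(\mathbb X,\mathbb Y)=\{(X_t,Y_t)\}_{t=1}^\infty$ with values in $\mathcal X\times\mathcal Y$ for which $\mathbb X=\{X_t\}_{t=1}^\infty$ is stationary (for every $k\ge 0$, the sequence $(X_{t+k})_{t\ge 1}$ has the same law as $(X_t)_{t\ge 1}$; ergodicity is not assumed, and $\mathbb Y=\{Y_t\}_{t=1}^\infty$ is arbitrary), and for every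 measurable function $f_0:\mathcal X\to\mathcal Y$, $$\limsup_{T\to\infty}\frac1T\sum_{t=1}^{T}\Bigl(\ell\bigl(f_t(r,X_{1:(t-1)},Y_{1:(t-1)},X_t),Y_t\bigr)-\ell\bigl(f_0(X_t),Y_t\bigr)\Bigr)\le 0\quad\text{almost surely},$$ where the probability is over both the process and the independent internal randomness $r$. -/

import Mathlib

open MeasureTheory ProbabilityTheory Filter

universe u v w

/-- A stochastic process `(X_t, Y_t)`, `t = 0, 1, 2, …`, with values in `𝒳 × 𝒴`, on some
probability space `(Ω, P)`. -/
structure DataProcess (𝒳 : Type u) (𝒴 : Type v) [MeasurableSpace 𝒳] [MeasurableSpace 𝒴] where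
  Ω : Type w
  measurableSpace : MeasurableSpace Ω
  P : Measure Ω
  isProbabilityMeasure : IsProbabilityMeasure P
  X : ℕ → Ω → 𝒳
  Y : ℕ → Ω → 𝒴
  measurable_X : ∀ t, Measurable (X t)
  measurable_Y : ∀ t, Measurable (Y t)

attribute [instance] DataProcess.measurableSpace DataProcess.isProbabilityMeasure

/-- A process `X_0, X_1, …` is stationary if `(X_k, X_{k+1}, …)` has the same law (on the sequence
space) as `(X_0, X_1, …)`, for every `k`. -/
def IsStationaryProcess {Ω : Type w} {𝒳 : Type u} [MeasurableSpace Ω] [MeasurableSpace 𝒳]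
    (X : ℕ → Ω → 𝒳) (P : Measure Ω) : Prop :=
  ∀ k : ℕ, IdentDistrib (fun ω (t : ℕ) => X (t + k) ω) (fun ω (t : ℕ) => X t ω) P P

/-- A (randomized) online learning rule. The internal randomness is a point `r` of a probability
space `(Seed, seedLaw)`; at time `t` the rule sees the `t` earlier points and responses and the
current point, and predicts a response. The prediction is jointly measurable in all arguments,
the internal randomness included. -/
structure OnlineLearningRule (𝒳 : Type u) (𝒴 : Type v) [MeasurableSpace 𝒳]
    [MeasurableSpace 𝒴] where
  Seed : Type
  seedMeasurableSpace : MeasurableSpace Seed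
  seedLaw : Measure Seed
  isProbabilityMeasure_seedLaw : IsProbabilityMeasure seedLaw
  predict : (t : ℕ) → Seed → (Fin t → 𝒳) → (Fin t → 𝒴) → 𝒳 → 𝒴
  measurable_predict : ∀ t : ℕ, Measurable
    (fun z : Seed × (Fin t → 𝒳) × (Fin t → 𝒴) × 𝒳 => predict t z.1 z.2.1 z.2.2.1 z.2.2.2)

attribute [instance] OnlineLearningRule.seedMeasurableSpace
  OnlineLearningRule.isProbabilityMeasure_seedLaw

namespace OnlineLearningRule

/-- The long-run average excess loss, over `f₀`, of the rule with internal randomness `r`, along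
the data sequence `(x_t, y_t)`; the loss is the metric of `𝒴`. When that metric is bounded, the
averages are bounded and this is the true upper limit. -/
noncomputable def excessLoss {𝒳 : Type u} {𝒴 : Type v} [MeasurableSpace 𝒳] [MetricSpace 𝒴]
    [MeasurableSpace 𝒴] (f : OnlineLearningRule 𝒳 𝒴) (f₀ : 𝒳 → 𝒴) (r : f.Seed)
    (x : ℕ → 𝒳) (y : ℕ → 𝒴) : ℝ :=
  limsup (fun T : ℕ => (1 / (T : ℝ)) * ∑ t ∈ Finset.range T,
    (dist (f.predict t r (fun s : Fin t => x s) (fun s : Fin t => y s) (x t)) (y t)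
      - dist (f₀ (x t)) (y t))) atTop

/-- Strong universal consistency for a family `C` of processes. The internal randomness is
independent of the data, so the pair (data, internal randomness) lives on the product space. -/
def StronglyUniversallyConsistent {𝒳 : Type u} {𝒴 : Type v} [MeasurableSpace 𝒳]
    [MetricSpace 𝒴] [MeasurableSpace 𝒴] (f : OnlineLearningRule 𝒳 𝒴)
    (C : Set (DataProcess.{u, v, w} 𝒳 𝒴)) : Prop :=
  ∀ p ∈ C, ∀ f₀ : 𝒳 → 𝒴, Measurable f₀ →
    ∀ᵐ z ∂(p.P.prod f.seedLaw),
      f.excessLoss f₀ z.2 (fun t => p.X t z.1) (fun t => p.Y t z.1) ≤ 0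

end OnlineLearningRule

/-! The rule plays exponential weights over a countable family of experts. Two facts carry the
proof. (a) One countable family `F` is dense in `L¹(μ)` for every finite `μ` at once
(`exists_seq_measurable_dense_integral_dist`), so it can be fixed before the law of the process is
known. (b) For every fixed data path, the randomized forecaster has regret `o(T)` against each `F
i`, almost surely in the seed (`ae_forall_eventually_expWeightRule_le`). Hence `Y` may be arbitrary.
It remains to compare `f₀` with some `F i` along the path. By the maximal ergodic inequality, the
event that an average of `dist (F i) f₀` ever exceeds `ε` has probability at most the `L¹` distance
divided by `ε`. Density makes this arbitrarily small, so almost surely some random `i` stays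
`ε`-close on average for all `T`. Neither ergodicity nor convergence of averages is needed. The
triangle inequality concludes. -/

/-! ### Piecewise constant functions coded by lists -/

section PiecewiseFunctions

variable {α : Type*} {β : Type*}

open Classical in
/-- The function with value `d n` on `A`, for the first pair `(A, n)` of the list whose set
contains the argument, and `d 0` if there is none. -/
noncomputable def listPiecewise (d : ℕ → β) : List (Set α × ℕ) → α → β
  | [] => fun _ => d 0
  | p :: l => p.1.piecewise (fun _ => d p.2) (listPiecewise d l)

variable [MeasurableSpace α] [MeasurableSpace β]

theorem measurable_listPiecewise (d : ℕ → β) (l : List (Set α × ℕ))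
    (hl : ∀ p ∈ l, MeasurableSet p.1) : Measurable (listPiecewise d l) := by
  classical
  induction l with
  | nil => exact measurable_const
  | cons p l ih =>
    exact Measurable.piecewise (hl p (by simp)) measurable_const
      (ih fun q hq => hl q (by simp [hq]))

end PiecewiseFunctions

/-! ### A countable family dense in `L¹` for all finite measures -/

section Approximation

open scoped symmDiff

variable {α : Type*} {β : Type*} [MeasurableSpace α] [MetricSpace β] [BoundedSpace β]

theorem dist_le_diam_univ (x y : β) : dist x y ≤ Metric.diam (Set.univ : Set β) :=
  Metric.dist_le_diam_of_mem (Bornology.IsBounded.all _) trivial trivial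

variable [TopologicalSpace.SeparableSpace β] [MeasurableSpace β] [BorelSpace β]

theorem integrable_dist_of_measurable {μ : Measure α} [IsFiniteMeasure μ] {f g : α → β}
    (hf : Measurable f) (hg : Measurable g) : Integrable (fun x => dist (f x) (g x)) μ := by
  have := UniformSpace.secondCountable_of_separable β
  refine Integrable.of_bound (hf.dist hg).aestronglyMeasurable (Metric.diam (Set.univ : Set β))
    (ae_of_all _ fun x => ?_)
  rw [Real.norm_of_nonneg dist_nonneg]
  exact dist_le_diam_univ _ _

open Classical in
theorem integral_dist_piecewise_le {μ : Measure α} [IsFiniteMeasure μ] {f g : α → β}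
    (hf : Measurable f) (hg : Measurable g) (c : β) {s t : Set α} (hs : MeasurableSet s)
    (ht : MeasurableSet t) :
    ∫ x, dist (t.piecewise (fun _ => c) g x) (s.piecewise (fun _ => c) f x) ∂μ
      ≤ Metric.diam (Set.univ : Set β) * μ.real (s ∆ t) + ∫ x, dist (g x) (f x) ∂μ := by
  set D := Metric.diam (Set.univ : Set β)
  have hD : 0 ≤ D := Metric.diam_nonneg
  have hst : MeasurableSet (s ∆ t) := hs.symmDiff ht
  have hi : Integrable ((s ∆ t).indicator fun _ => D) μ := (integrable_const D).indicator hst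
  calc _ ≤ ∫ x, ((s ∆ t).indicator (fun _ => D) x + dist (g x) (f x)) ∂μ := by
        refine integral_mono (integrable_dist_of_measurable (measurable_const.piecewise ht hg)
          (measurable_const.piecewise hs hf)) (hi.add (integrable_dist_of_measurable hg hf)) fun x => ?_
        by_cases h1 : x ∈ s <;> by_cases h2 : x ∈ t <;>
          simp [h1, h2, Set.mem_symmDiff, Set.indicator]
        · exact (dist_le_diam_univ _ _).trans (le_add_of_nonneg_right dist_nonneg)
        · exact (dist_le_diam_univ _ _).trans (le_add_of_nonneg_right dist_nonneg)
    _ = _ := by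
        rw [integral_add hi (integrable_dist_of_measurable hg hf), integral_indicator_const _ hst, smul_eq_mul,
          mul_comm]

/-- Going from `N` to `N + 1`, the nearest point changes only on the measurable set where `d (N +
1)` is strictly closest. Replacing that set by a nearby member of `𝒜` costs at most the diameter
times the measure of the symmetric difference. -/
theorem exists_listPiecewise_integral_dist_nearestPt_le {μ : Measure α} [IsFiniteMeasure μ]
    {𝒜 : Set (Set α)} (h𝒜 : μ.MeasureDense 𝒜) (d : ℕ → β) {f : α → β} (hf : Measurable f)
    (N : ℕ) {ε : ℝ} (hε : 0 < ε) :
    ∃ l : List (Set α × ℕ), (∀ p ∈ l, p.1 ∈ 𝒜) ∧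
      ∫ x, dist (listPiecewise d l x) (SimpleFunc.nearestPt d N (f x)) ∂μ ≤ ε := by
  classical
  induction N generalizing ε with
  | zero => exact ⟨[], by simp, by simpa [listPiecewise] using hε.le⟩
  | succ N ih =>
    set D := Metric.diam (Set.univ : Set β)
    have hD : 0 ≤ D := Metric.diam_nonneg
    obtain ⟨l, hl, hle⟩ := ih (half_pos hε)
    let s : Set α := f ⁻¹' (⋂ k ≤ N, {x | edist (d (N + 1)) x < edist (d k) x})
    have hs : MeasurableSet s := hf (MeasurableSet.iInter fun _ => MeasurableSet.iInter fun _ =>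
      measurableSet_lt measurable_edist_right measurable_edist_right)
    -- The denominator is `D + 1` because `D` may be zero.
    obtain ⟨t, ht, hst⟩ := h𝒜.approx s hs (measure_ne_top _ _) (ε / 2 / (D + 1)) (by positivity)
    refine ⟨(t, N + 1) :: l, by simpa [ht] using hl, ?_⟩
    have hm : Measurable fun x => SimpleFunc.nearestPt d N (f x) :=
      (SimpleFunc.measurable _).comp hf
    have heq : ∀ x, SimpleFunc.nearestPt d (N + 1) (f x)
        = s.piecewise (fun _ => d (N + 1)) (fun x => SimpleFunc.nearestPt d N (f x)) x := by
      intro x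
      simp only [SimpleFunc.nearestPt, SimpleFunc.map_apply, SimpleFunc.nearestPtInd_succ,
        Set.piecewise, s, Set.mem_preimage, Set.mem_iInter, Set.mem_ofPred_eq]
      split_ifs <;> rfl
    simp_rw [heq]
    refine (integral_dist_piecewise_le hm
      (measurable_listPiecewise d l fun p hp => h𝒜.measurable _ (hl p hp)) _ hs
      (h𝒜.measurable t ht)).trans ?_
    have h1 : μ.real (s ∆ t) ≤ ε / 2 / (D + 1) :=
      ENNReal.toReal_le_of_le_ofReal (by positivity) hst.le
    have h2 : D * μ.real (s ∆ t) ≤ ε / 2 := by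
      calc _ ≤ (D + 1) * (ε / 2 / (D + 1)) :=
            mul_le_mul (by linarith) h1 measureReal_nonneg (by positivity)
        _ = ε / 2 := by field_simp
    linarith

theorem exists_listPiecewise_integral_dist_le {μ : Measure α} [IsFiniteMeasure μ]
    {𝒜 : Set (Set α)} (h𝒜 : μ.MeasureDense 𝒜) {d : ℕ → β} (hd : DenseRange d) {f : α → β}
    (hf : Measurable f) {ε : ℝ} (hε : 0 < ε) :
    ∃ l : List (Set α × ℕ), (∀ p ∈ l, p.1 ∈ 𝒜) ∧
      ∫ x, dist (listPiecewise d l x) (f x) ∂μ ≤ ε := by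
  have hm : ∀ N, Measurable fun x => SimpleFunc.nearestPt d N (f x) := fun N =>
    (SimpleFunc.measurable _).comp hf
  have hlim : Tendsto (fun N => ∫ x, dist (SimpleFunc.nearestPt d N (f x)) (f x) ∂μ) atTop
      (nhds (∫ _, (0 : ℝ) ∂μ)) := by
    refine tendsto_integral_of_dominated_convergence
      (fun _ => Metric.diam (Set.univ : Set β))
      (fun N => (integrable_dist_of_measurable (hm N) hf).aestronglyMeasurable) (integrable_const _)
      (fun N => ae_of_all _ fun x => ?_) (ae_of_all _ fun x => ?_)
    · rw [Real.norm_of_nonneg dist_nonneg]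
      exact dist_le_diam_univ _ _
    · exact tendsto_iff_dist_tendsto_zero.1 (SimpleFunc.tendsto_nearestPt (hd (f x)))
  rw [integral_zero] at hlim
  obtain ⟨N, hN⟩ := (hlim.eventually_lt_const (half_pos hε)).exists
  obtain ⟨l, hl, hle⟩ :=
    exists_listPiecewise_integral_dist_nearestPt_le h𝒜 d hf N (half_pos hε)
  have hlm := measurable_listPiecewise d l fun p hp => h𝒜.measurable _ (hl p hp)
  refine ⟨l, hl, ?_⟩
  calc _ ≤ ∫ x, (dist (listPiecewise d l x) (SimpleFunc.nearestPt d N (f x))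
          + dist (SimpleFunc.nearestPt d N (f x)) (f x)) ∂μ :=
        integral_mono (integrable_dist_of_measurable hlm hf)
          ((integrable_dist_of_measurable hlm (hm N)).add (integrable_dist_of_measurable (hm N) hf))
          fun x => dist_triangle _ _ _
    _ ≤ ε := by
        rw [integral_add (integrable_dist_of_measurable hlm (hm N)) (integrable_dist_of_measurable (hm N) hf)]
        linarith

/-- On a countably generated measurable space there is a countable family of measurable functions
that is dense in `L¹(μ)` simultaneously for all finite measures `μ`. -/
theorem exists_seq_measurable_dense_integral_dist (α : Type*) (β : Type*) [MeasurableSpace α]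
    [MeasurableSpace.CountablyGenerated α] [Nonempty β] [MetricSpace β] [BoundedSpace β]
    [TopologicalSpace.SeparableSpace β] [MeasurableSpace β] [BorelSpace β] :
    ∃ F : ℕ → α → β, (∀ i, Measurable (F i)) ∧
      ∀ (μ : Measure α) [IsFiniteMeasure μ] (f : α → β), Measurable f → ∀ ε : ℝ, 0 < ε →
        ∃ i, ∫ x, dist (F i x) (f x) ∂μ ≤ ε := by
  -- This countable algebra does not depend on `μ`, yet approximates measurable sets for every
  -- finite `μ`.
  let 𝒜 := generateSetAlgebra (MeasurableSpace.countableGeneratingSet α)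
  have hgen : ‹MeasurableSpace α› = MeasurableSpace.generateFrom 𝒜 := by
    rw [generateFrom_generateSetAlgebra_eq, MeasurableSpace.generateFrom_countableGeneratingSet]
  have hdense : ∀ (μ : Measure α) [IsFiniteMeasure μ], μ.MeasureDense 𝒜 := fun μ _ =>
    Measure.MeasureDense.of_generateFrom_isSetAlgebra_finite μ isSetAlgebra_generateSetAlgebra hgen
  have hc : Countable 𝒜 := countable_generateSetAlgebra
    (MeasurableSpace.countable_countableGeneratingSet)
  let d := TopologicalSpace.denseSeq β
  obtain ⟨e, he⟩ := exists_surjective_nat (List (𝒜 × ℕ))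
  let toSets : List (𝒜 × ℕ) → List (Set α × ℕ) := List.map fun p => (p.1, p.2)
  refine ⟨fun i => listPiecewise d (toSets (e i)), fun i => ?_, fun μ _ f hf ε hε => ?_⟩
  · refine measurable_listPiecewise d _ fun p hp => ?_
    obtain ⟨q, -, rfl⟩ := List.mem_map.1 hp
    -- Density includes measurability of the members of `𝒜`; any finite measure would do here.
    exact (hdense 0).measurable _ q.1.2
  · obtain ⟨l, hl, hle⟩ := exists_listPiecewise_integral_dist_le (hdense μ)
      (TopologicalSpace.denseRange_denseSeq β) hf hε
    let l' : List (𝒜 × ℕ) := l.pmap (fun p hp => (⟨p.1, hp⟩, p.2)) hl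
    obtain ⟨i, hi⟩ := he l'
    refine ⟨i, ?_⟩
    have : toSets (e i) = l := by simp [hi, toSets, l', List.map_pmap]
    simpa only [this] using hle

end Approximation

/-! ### Maximal ergodic theorem -/

section MaximalErgodic

variable {α : Type*}

/-- The maximum of `0` and the first `n` Birkhoff sums of `f`. -/
def birkhoffMax (T : α → α) (f : α → ℝ) : ℕ → α → ℝ
  | 0 => fun _ => 0
  | n + 1 => fun x => max 0 (f x + birkhoffMax T f n (T x))

theorem birkhoffMax_nonneg (T : α → α) (f : α → ℝ) (n : ℕ) (x : α) : 0 ≤ birkhoffMax T f n x := by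
  cases n with
  | zero => exact le_rfl
  | succ n => exact le_max_left _ _

theorem birkhoffMax_le_succ (T : α → α) (f : α → ℝ) (n : ℕ) (x : α) :
    birkhoffMax T f n x ≤ birkhoffMax T f (n + 1) x := by
  induction n generalizing x with
  | zero => exact birkhoffMax_nonneg _ _ _ _
  | succ n ih => exact max_le_max le_rfl (add_le_add le_rfl (ih (T x)))

theorem birkhoffSum_le_birkhoffMax (T : α → α) (f : α → ℝ) (n : ℕ) (x : α) :
    birkhoffSum T f n x ≤ birkhoffMax T f n x := by
  induction n generalizing x with
  | zero => simp [birkhoffMax]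
  | succ n ih =>
    rw [birkhoffSum_succ']
    exact (add_le_add le_rfl (ih (T x))).trans (le_max_right _ _)

variable [MeasurableSpace α]

theorem measurable_birkhoffMax {T : α → α} {f : α → ℝ} (hT : Measurable T) (hf : Measurable f)
    (n : ℕ) : Measurable (birkhoffMax T f n) := by
  induction n with
  | zero => exact measurable_const
  | succ n ih => exact measurable_const.max (hf.add (ih.comp hT))

variable {μ : Measure α}

theorem integrable_birkhoffMax {T : α → α} {f : α → ℝ} (hT : MeasurePreserving T μ μ)
    (hf : Integrable f μ) (n : ℕ) : Integrable (birkhoffMax T f n) μ := by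
  induction n with
  | zero => exact integrable_zero _ _ _
  | succ n ih => exact (integrable_zero _ _ _).sup (hf.add (hT.integrable_comp_of_integrable ih))

/-- The **maximal ergodic theorem**. -/
theorem setIntegral_birkhoffMax_pos_nonneg {T : α → α} {f : α → ℝ} (hT : MeasurePreserving T μ μ)
    (hfm : Measurable f) (hf : Integrable f μ) (n : ℕ) :
    0 ≤ ∫ x in {x | 0 < birkhoffMax T f n x}, f x ∂μ := by
  set M := birkhoffMax T f n
  have hM : Integrable M μ := integrable_birkhoffMax hT hf n
  have hMm : Measurable M := measurable_birkhoffMax hT.measurable hfm n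
  have hMT : Integrable (fun x => M (T x)) μ := hT.integrable_comp_of_integrable hM
  have hs : MeasurableSet {x | 0 < M x} := measurableSet_lt measurable_const hMm
  -- Garsia's argument: where `M > 0`, the recursion and monotonicity in `n` give `M ≤ f + M ∘ T`;
  -- elsewhere `M ≤ 0 ≤ M ∘ T`. The left side integrates to zero by invariance.
  have hle : ∀ x, M x - M (T x) ≤ {x | 0 < M x}.indicator f x := by
    intro x
    by_cases hx : 0 < M x
    · rw [Set.indicator_of_mem (show x ∈ {x | 0 < M x} from hx)]
      cases n with
      | zero => exact absurd hx (lt_irrefl _)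
      | succ n =>
        have h1 : M x = f x + birkhoffMax T f n (T x) := by
          rcases max_choice 0 (f x + birkhoffMax T f n (T x)) with h | h
          · exact absurd (show M x = 0 from h) hx.ne'
          · exact h
        have h2 : birkhoffMax T f n (T x) ≤ M (T x) := birkhoffMax_le_succ T f n (T x)
        linarith
    · rw [Set.indicator_of_notMem (show x ∉ {x | 0 < M x} from hx)]
      have := birkhoffMax_nonneg T f n (T x)
      linarith
  have h := integral_mono (hM.sub hMT) (hf.indicator hs) hle
  rw [integral_indicator hs] at h
  have hz : ∫ x, (M x - M (T x)) ∂μ = 0 := by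
    rw [integral_sub hM hMT, ← integral_map hT.aemeasurable (by
      rw [hT.map_eq]; exact hM.aestronglyMeasurable), hT.map_eq, sub_self]
  exact hz ▸ h

/-- The maximal inequality for the Birkhoff averages of a nonnegative function. -/
theorem measure_exists_lt_birkhoffSum_le [IsFiniteMeasure μ] {T : α → α} {f : α → ℝ}
    (hT : MeasurePreserving T μ μ) (hfm : Measurable f) (hf : Integrable f μ) (h0 : ∀ x, 0 ≤ f x)
    {a : ℝ} (ha : 0 < a) :
    μ {x | ∃ n : ℕ, a * n < birkhoffSum T f n x} ≤ ENNReal.ofReal ((∫ x, f x ∂μ) / a) := by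
  let g : α → ℝ := fun x => f x - a
  let s : ℕ → Set α := fun n => {x | 0 < birkhoffMax T g n x}
  have hgm : Measurable g := hfm.sub_const a
  have hg : Integrable g μ := hf.sub (integrable_const a)
  have hsm : Monotone s := monotone_nat_of_le_succ fun n x hx =>
    lt_of_lt_of_le hx (birkhoffMax_le_succ T g n x)
  have hsub : {x | ∃ n : ℕ, a * n < birkhoffSum T f n x} ⊆ ⋃ n, s n := by
    rintro x ⟨n, hn⟩
    refine Set.mem_iUnion.2 ⟨n, lt_of_lt_of_le ?_ (birkhoffSum_le_birkhoffMax T g n x)⟩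
    simp only [birkhoffSum, g, Finset.sum_sub_distrib, Finset.sum_const, Finset.card_range,
      nsmul_eq_mul] at hn ⊢
    linarith
  refine (measure_mono hsub).trans ?_
  -- The union is increasing, so a bound uniform in `n` controls all times at once.
  rw [hsm.measure_iUnion]
  refine iSup_le fun n => ?_
  have hs : MeasurableSet (s n) :=
    measurableSet_lt measurable_const (measurable_birkhoffMax hT.measurable hgm n)
  rw [← ofReal_measureReal]
  refine ENNReal.ofReal_le_ofReal ((le_div_iff₀ ha).2 ?_)
  have h1 : 0 ≤ ∫ x in s n, g x ∂μ := setIntegral_birkhoffMax_pos_nonneg hT hgm hg n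
  have h2 : ∫ x in s n, g x ∂μ = ∫ x in s n, f x ∂μ - μ.real (s n) * a := by
    rw [integral_sub hf.integrableOn (integrable_const a)]
    simp
  have h3 : ∫ x in s n, f x ∂μ ≤ ∫ x, f x ∂μ := setIntegral_le_integral hf (ae_of_all _ h0)
  linarith

end MaximalErgodic

/-! ### Maximal inequality along a stationary process -/

section Stationary

variable {Ω : Type*} {α : Type*} [MeasurableSpace Ω] [MeasurableSpace α] {P : Measure Ω}

theorem birkhoffSum_shift {α : Type*} (f : α → ℝ) (n : ℕ) (x : ℕ → α) :
    birkhoffSum (fun (x : ℕ → α) t => x (t + 1)) (fun x => f (x 0)) n x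
      = ∑ t ∈ Finset.range n, f (x t) := by
  have : ∀ k : ℕ, (fun (x : ℕ → α) t => x (t + 1))^[k] x = fun t => x (t + k) := by
    intro k
    induction k with
    | zero => rfl
    | succ k ih => rw [Function.iterate_succ_apply', ih]; ext t; simp only []; congr 1; ring
  simp [birkhoffSum, this]

/-- Stationarity makes the shift preserve the law of the path; the sums are then Birkhoff sums of a
function of the zeroth coordinate. -/
theorem measure_exists_lt_sum_le_of_identDistrib_shift [IsProbabilityMeasure P]
    {X : ℕ → Ω → α} (hX : ∀ t, Measurable (X t))
    (hst : IdentDistrib (fun ω (t : ℕ) => X (t + 1) ω) (fun ω (t : ℕ) => X t ω) P P)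
    {f : α → ℝ} (hf : Measurable f) (hint : Integrable f (P.map (X 0))) (h0 : ∀ x, 0 ≤ f x)
    {a : ℝ} (ha : 0 < a) :
    P {ω | ∃ n : ℕ, a * n < ∑ t ∈ Finset.range n, f (X t ω)}
      ≤ ENNReal.ofReal ((∫ x, f x ∂(P.map (X 0))) / a) := by
  let path : Ω → ℕ → α := fun ω t => X t ω
  let S : (ℕ → α) → ℕ → α := fun x t => x (t + 1)
  have hpath : Measurable path := measurable_pi_lambda _ hX
  have hS : Measurable S := measurable_pi_lambda _ fun t => measurable_pi_apply _
  have hpres : MeasurePreserving S (P.map path) (P.map path) :=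
    ⟨hS, by rw [Measure.map_map hS hpath]; exact hst.map_eq⟩
  have : IsProbabilityMeasure (P.map path) := Measure.isProbabilityMeasure_map hpath.aemeasurable
  have h0map : (P.map path).map (fun x => x 0) = P.map (X 0) := by
    rw [Measure.map_map (measurable_pi_apply 0) hpath]; rfl
  have hint' : Integrable (fun x : ℕ → α => f (x 0)) (P.map path) := by
    rw [← h0map] at hint
    exact hint.comp_measurable (measurable_pi_apply 0)
  have key := measure_exists_lt_birkhoffSum_le hpres (hf.comp (measurable_pi_apply 0)) hint'
    (fun x => h0 _) ha
  have hint_eq : ∫ x, f (x 0) ∂(P.map path) = ∫ x, f x ∂(P.map (X 0)) := by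
    rw [← h0map, integral_map (measurable_pi_apply 0).aemeasurable hf.aestronglyMeasurable]
  refine le_trans ?_ (key.trans_eq (by simp only [Function.comp_apply, hint_eq]))
  refine le_trans (measure_mono fun ω hω => ?_) (Measure.le_map_apply hpath.aemeasurable _)
  obtain ⟨n, hn⟩ := hω
  refine ⟨n, ?_⟩
  rw [show birkhoffSum S (f ∘ fun x => x 0) n (path ω) = _ from birkhoffSum_shift f n (path ω)]
  exact hn

end Stationary

/-! ### Exponential weights with decreasing learning rates -/

section ExponentialWeights

theorem Real.exp_neg_le_quadratic {x : ℝ} (hx : 0 ≤ x) : Real.exp (-x) ≤ 1 - x + x ^ 2 / 2 := by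
  have h := Real.quadratic_le_exp_of_nonneg hx
  have hq : 0 < 1 - x + x ^ 2 / 2 := by nlinarith [sq_nonneg (x - 1)]
  rw [Real.exp_neg, inv_le_iff_one_le_mul₀ (Real.exp_pos x)]
  have : (1 - x + x ^ 2 / 2) * (1 + x + x ^ 2 / 2) = 1 + x ^ 4 / 4 := by ring
  nlinarith [mul_le_mul_of_nonneg_left h hq.le, sq_nonneg (x ^ 2)]

theorem Real.exp_mul_le_affine {r : ℝ} (h0 : 0 ≤ r) (h1 : r ≤ 1) (b : ℝ) :
    Real.exp (r * b) ≤ 1 - r + r * Real.exp b := by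
  have := convexOn_exp.2 (Set.mem_univ (0 : ℝ)) (Set.mem_univ b) (sub_nonneg.2 h1) h0 (by ring)
  simpa using this

variable {π : ℕ → ℝ}

theorem summable_mul_of_mem_Icc (hπ : ∀ i, 0 ≤ π i) (hs : Summable π) {a : ℕ → ℝ} {C : ℝ}
    (ha : ∀ i, a i ∈ Set.Icc 0 C) : Summable fun i => π i * a i :=
  Summable.of_nonneg_of_le (fun i => mul_nonneg (hπ i) (ha i).1)
    (fun i => mul_le_mul_of_nonneg_left (ha i).2 (hπ i)) (hs.mul_right C)

theorem exp_neg_mul_mem_Icc {η x : ℝ} (hη : 0 ≤ η) (hx : 0 ≤ x) :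
    Real.exp (-(η * x)) ∈ Set.Icc 0 1 :=
  ⟨(Real.exp_pos _).le, Real.exp_le_one_iff.2 (neg_nonpos.2 (mul_nonneg hη hx))⟩

/-- The total weight `∑ᵢ πᵢ exp (-η Lᵢ)`. -/
noncomputable def expWeightSum (π : ℕ → ℝ) (η : ℝ) (L : ℕ → ℝ) : ℝ :=
  ∑' i, π i * Real.exp (-(η * L i))

/-- The mean of `ℓ` under the weights `πᵢ exp (-η Lᵢ)`. -/
noncomputable def expWeightMean (π : ℕ → ℝ) (η : ℝ) (L ℓ : ℕ → ℝ) : ℝ :=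
  (∑' i, π i * Real.exp (-(η * L i)) * ℓ i) / expWeightSum π η L

theorem summable_expWeight (hπ : ∀ i, 0 < π i) (hs : Summable π) {η : ℝ} (hη : 0 ≤ η)
    {L : ℕ → ℝ} (hL : ∀ i, 0 ≤ L i) : Summable fun i => π i * Real.exp (-(η * L i)) :=
  summable_mul_of_mem_Icc (fun i => (hπ i).le) hs fun i => exp_neg_mul_mem_Icc hη (hL i)

theorem expWeight_le_sum (hπ : ∀ i, 0 < π i) (hs : Summable π) {η : ℝ} (hη : 0 ≤ η)
    {L : ℕ → ℝ} (hL : ∀ i, 0 ≤ L i) (i : ℕ) :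
    π i * Real.exp (-(η * L i)) ≤ expWeightSum π η L :=
  (summable_expWeight hπ hs hη hL).le_tsum i fun j _ =>
    mul_nonneg (hπ j).le (Real.exp_pos _).le

theorem expWeightSum_pos (hπ : ∀ i, 0 < π i) (hs : Summable π) {η : ℝ} (hη : 0 ≤ η)
    {L : ℕ → ℝ} (hL : ∀ i, 0 ≤ L i) : 0 < expWeightSum π η L :=
  (mul_pos (hπ 0) (Real.exp_pos _)).trans_le (expWeight_le_sum hπ hs hη hL 0)

/-- One round at a fixed rate: averaging `exp (-x) ≤ 1 - x + x² / 2` under the current weights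
bounds the new total weight, and `1 + x ≤ exp x` turns this into a bound on logarithms. -/
theorem log_expWeightSum_add_le (hπ : ∀ i, 0 < π i) (hs : Summable π) {η D : ℝ} (hη : 0 ≤ η)
    {L ℓ : ℕ → ℝ} (hL : ∀ i, 0 ≤ L i) (hℓ : ∀ i, ℓ i ∈ Set.Icc 0 D) :
    Real.log (expWeightSum π η fun i => L i + ℓ i)
      ≤ Real.log (expWeightSum π η L) - η * expWeightMean π η L ℓ + η ^ 2 * D ^ 2 / 2 := by
  have hw := summable_expWeight hπ hs hη hL
  have hw0 : ∀ i, 0 ≤ π i * Real.exp (-(η * L i)) := fun i =>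
    mul_nonneg (hπ i).le (Real.exp_pos _).le
  have hwℓ := summable_mul_of_mem_Icc hw0 hw hℓ
  have hL' : ∀ i, 0 ≤ L i + ℓ i := fun i => add_nonneg (hL i) (hℓ i).1
  have hW := expWeightSum_pos hπ hs hη hL
  have hV := expWeightSum_pos hπ hs hη hL'
  set W := expWeightSum π η L with hWdef
  set m := expWeightMean π η L ℓ with hm
  have hmW : ∑' i, π i * Real.exp (-(η * L i)) * ℓ i = m * W := by
    rw [hm, expWeightMean, div_mul_cancel₀ _ hW.ne']
  have hle : (expWeightSum π η fun i => L i + ℓ i) ≤ W * (1 - η * m + η ^ 2 * D ^ 2 / 2) := by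
    have hsum : HasSum (fun i => π i * Real.exp (-(η * L i)) * (1 + η ^ 2 * D ^ 2 / 2)
        - η * (π i * Real.exp (-(η * L i)) * ℓ i))
        (W * (1 + η ^ 2 * D ^ 2 / 2) - η * (m * W)) :=
      (hw.hasSum.mul_right _).sub (hmW ▸ hwℓ.hasSum.mul_left η)
    refine (hasSum_le (fun i => ?_) (summable_expWeight hπ hs hη hL').hasSum hsum).trans_eq
      (by ring)
    have h1 := Real.exp_neg_le_quadratic (mul_nonneg hη (hℓ i).1)
    have h2 : (η * ℓ i) ^ 2 ≤ η ^ 2 * D ^ 2 := by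
      rw [mul_pow]
      exact mul_le_mul_of_nonneg_left (pow_le_pow_left₀ (hℓ i).1 (hℓ i).2 2) (sq_nonneg _)
    have h3 : Real.exp (-(η * (L i + ℓ i))) = Real.exp (-(η * L i)) * Real.exp (-(η * ℓ i)) := by
      rw [← Real.exp_add]; congr 1; ring
    rw [h3, ← mul_assoc]
    calc _ ≤ π i * Real.exp (-(η * L i)) * (1 - η * ℓ i + η ^ 2 * D ^ 2 / 2) :=
          mul_le_mul_of_nonneg_left (by linarith) (hw0 i)
      _ = _ := by ring
  have hle' : (expWeightSum π η fun i => L i + ℓ i)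
      ≤ W * Real.exp (-(η * m) + η ^ 2 * D ^ 2 / 2) := by
    refine hle.trans (mul_le_mul_of_nonneg_left ?_ hW.le)
    linarith [Real.add_one_le_exp (-(η * m) + η ^ 2 * D ^ 2 / 2)]
  have := Real.log_le_log hV hle'
  rw [Real.log_mul hW.ne' (Real.exp_pos _).ne', Real.log_exp] at this
  linarith

/-- Since `π` is a probability, this is monotonicity of power means. It lets the learning rate
decrease between rounds without raising the potential `-log W / η`. -/
theorem log_expWeightSum_div_antitone (hπ : ∀ i, 0 < π i) (hs : HasSum π 1) {η η' : ℝ}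
    (hη' : 0 < η') (hle : η' ≤ η) {L : ℕ → ℝ} (hL : ∀ i, 0 ≤ L i) :
    Real.log (expWeightSum π η' L) / η' ≤ Real.log (expWeightSum π η L) / η := by
  have hη : 0 < η := hη'.trans_le hle
  have hV := expWeightSum_pos hπ hs.summable hη.le hL
  have hW := expWeightSum_pos hπ hs.summable hη'.le hL
  set V := expWeightSum π η L with hVdef
  set r := η' / η with hr
  have hr0 : 0 ≤ r := by positivity
  have hr1 : r ≤ 1 := (div_le_one hη).2 hle
  have hle : expWeightSum π η' L ≤ Real.exp (r * Real.log V) := by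
    have hsum : HasSum (fun i => Real.exp (r * Real.log V) *
        ((π i * (1 - r)) + r / V * (π i * Real.exp (-(η * L i)))))
        (Real.exp (r * Real.log V) * (1 * (1 - r) + r / V * V)) :=
      ((hs.mul_right _).add
        ((summable_expWeight hπ hs.summable hη.le hL).hasSum.mul_left _)).mul_left _
    refine (hasSum_le (fun i => ?_) (summable_expWeight hπ hs.summable hη'.le hL).hasSum
      hsum).trans_eq ?_
    · have h1 := Real.exp_mul_le_affine hr0 hr1 (-(η * L i) - Real.log V)
      have h2 : Real.exp (-(η' * L i))
          = Real.exp (r * Real.log V) * Real.exp (r * (-(η * L i) - Real.log V)) := by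
        rw [← Real.exp_add]; congr 1; rw [hr]; field_simp; ring
      have h3 : Real.exp (-(η * L i) - Real.log V) = Real.exp (-(η * L i)) / V := by
        rw [Real.exp_sub, Real.exp_log hV]
      rw [h3] at h1
      rw [h2]
      calc _ = π i * Real.exp (r * Real.log V) * Real.exp (r * (-(η * L i) - Real.log V)) := by ring
        _ ≤ π i * Real.exp (r * Real.log V) * (1 - r + r * (Real.exp (-(η * L i)) / V)) :=
            mul_le_mul_of_nonneg_left h1 (mul_nonneg (hπ i).le (Real.exp_pos _).le)
        _ = _ := by ring
    · rw [div_mul_cancel₀ _ hV.ne']; ring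
  have := Real.log_le_log hW hle
  rw [Real.log_exp] at this
  rw [div_le_iff₀ hη']
  calc _ ≤ _ := this
    _ = _ := by rw [hr]; ring

/-- The regret bound of the exponentially weighted average forecaster with a prior `π` on countably
many experts and nonincreasing learning rates `η`. -/
theorem sum_expWeightMean_le (hπ : ∀ i, 0 < π i) (hs : HasSum π 1) {η : ℕ → ℝ}
    (hη : ∀ t, 0 < η t) (hanti : Antitone η) {D : ℝ} {ℓ : ℕ → ℕ → ℝ}
    (hℓ : ∀ t i, ℓ t i ∈ Set.Icc 0 D) (i T : ℕ) :
    ∑ t ∈ Finset.range T, expWeightMean π (η t) (fun j => ∑ s ∈ Finset.range t, ℓ s j) (ℓ t)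
      ≤ ∑ t ∈ Finset.range T, ℓ t i - Real.log (π i) / η T
        + D ^ 2 / 2 * ∑ t ∈ Finset.range T, η t := by
  let L : ℕ → ℕ → ℝ := fun t j => ∑ s ∈ Finset.range t, ℓ s j
  have hL : ∀ t j, 0 ≤ L t j := fun t j => Finset.sum_nonneg fun s _ => (hℓ s j).1
  have hpot : ∀ T, ∑ t ∈ Finset.range T, expWeightMean π (η t) (L t) (ℓ t)
      ≤ -(Real.log (expWeightSum π (η T) (L T)) / η T)
        + D ^ 2 / 2 * ∑ t ∈ Finset.range T, η t := by
    intro T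
    induction T with
    | zero => simp [expWeightSum, L, hs.tsum_eq]
    | succ T ih =>
      have h1 := log_expWeightSum_add_le hπ hs.summable (hη T).le (hL T) (hℓ T)
      have h2 := log_expWeightSum_div_antitone hπ hs (hη (T + 1)) (hanti T.le_succ) (hL (T + 1))
      have h3 : L (T + 1) = fun i => L T i + ℓ T i := by
        ext j; exact Finset.sum_range_succ _ _
      have h4 : Real.log (expWeightSum π (η T) (L (T + 1))) / η T
          ≤ Real.log (expWeightSum π (η T) (L T)) / η T - expWeightMean π (η T) (L T) (ℓ T)
            + D ^ 2 / 2 * η T := by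
        rw [div_le_iff₀ (hη T), h3]
        refine h1.trans_eq ?_
        have := (hη T).ne'
        field_simp
      rw [Finset.sum_range_succ, Finset.sum_range_succ, mul_add]
      linarith
  refine (hpot T).trans ?_
  -- The total weight is at least the weight of expert `i` alone.
  have h1 := Real.log_le_log (mul_pos (hπ i) (Real.exp_pos _))
    (expWeight_le_sum hπ hs.summable (hη T).le (hL T) i)
  rw [Real.log_mul (hπ i).ne' (Real.exp_pos _).ne', Real.log_exp] at h1
  have h2 : (Real.log (π i) + -(η T * L T i)) / η T = Real.log (π i) / η T - L T i := by
    have := (hη T).ne'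
    field_simp
    ring
  have h3 := div_le_div_of_nonneg_right h1 (hη T).le
  have h4 : L T i = ∑ t ∈ Finset.range T, ℓ t i := rfl
  linarith

end ExponentialWeights

/-! ### Sampling an expert from a uniform variable -/

section Sampling

/-- Sampling from the probability distribution on `ℕ` proportional to the weights `w`, from a
uniform random number `u` in `[0, 1)`, by inversion of the distribution function. -/
noncomputable def weightedIndex (w : ℕ → ℝ) (u : ℝ) : ℕ :=
  sInf {n | u * ∑' i, w i < ∑ i ∈ Finset.range (n + 1), w i}

theorem measurable_nat_sInf {γ : Type*} [MeasurableSpace γ] {p : γ → ℕ → Prop}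
    (hp : ∀ n, MeasurableSet {x | p x n}) : Measurable fun x => sInf {n | p x n} := by
  classical
  have hne : MeasurableSet {x | ∃ n, p x n} := by
    simp only [Set.ofPred_exists]
    exact MeasurableSet.iUnion hp
  -- Padding the predicate where no index satisfies it makes `Nat.find` return `0` there, matching
  -- `sInf ∅ = 0`.
  have hq : ∀ x, ∃ n, p x n ∨ ¬ ∃ m, p x m := fun x => by
    by_cases h : ∃ m, p x m
    · exact h.imp fun n hn => Or.inl hn
    · exact ⟨0, Or.inr h⟩
  have heq : (fun x => sInf {n | p x n}) = fun x => Nat.find (hq x) := by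
    ext x
    by_cases h : ∃ m, p x m
    · have h' : {n | p x n}.Nonempty := h
      rw [Nat.sInf_def h']
      refine Nat.find_congr' ?_
      intro n
      simp [h]
    · have h' : {n | p x n} = ∅ := by
        ext n; simpa using fun hn => h ⟨n, hn⟩
      rw [h', Nat.sInf_empty, eq_comm, Nat.find_eq_zero]
      exact Or.inr h
  rw [heq]
  exact measurable_find hq fun n => (hp n).union hne.compl

theorem measurable_weightedIndex {γ : Type*} [MeasurableSpace γ] {w : γ → ℕ → ℝ} {u : γ → ℝ}
    (hw : ∀ i, Measurable fun x => w x i) (hs : ∀ x, Summable (w x)) (hu : Measurable u) :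
    Measurable fun x => weightedIndex (w x) (u x) := by
  have hsum : Measurable fun x => ∑' i, w x i := by
    refine measurable_of_tendsto_metrizable (f := fun n x => ∑ i ∈ Finset.range n, w x i)
      (fun n => Finset.measurable_sum _ fun i _ => hw i) (tendsto_pi_nhds.2 fun x => ?_)
    exact (hs x).hasSum.tendsto_sum_nat
  exact measurable_nat_sInf fun n =>
    measurableSet_lt (hu.mul hsum) (Finset.measurable_sum _ fun i _ => hw i)

theorem weightedIndex_eq_iff {w : ℕ → ℝ} (hw : ∀ i, 0 < w i) (hs : Summable w) {u : ℝ}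
    (hu : u ∈ Set.Ico (0 : ℝ) 1) (n : ℕ) :
    weightedIndex w u = n ↔
      u ∈ Set.Ico ((∑ i ∈ Finset.range n, w i) / ∑' i, w i)
        ((∑ i ∈ Finset.range (n + 1), w i) / ∑' i, w i) := by
  have hW : 0 < ∑' i, w i := hs.tsum_pos (fun i => (hw i).le) 0 (hw 0)
  have hmono : Monotone fun n => ∑ i ∈ Finset.range n, w i :=
    monotone_nat_of_le_succ fun n => by
      rw [Finset.sum_range_succ]; linarith [hw n]
  have hne : {n | u * ∑' i, w i < ∑ i ∈ Finset.range (n + 1), w i}.Nonempty := by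
    have hlt : u * ∑' i, w i < ∑' i, w i := by nlinarith [hu.2]
    exact ((hs.hasSum.tendsto_sum_nat.comp (tendsto_add_atTop_nat 1)).eventually_const_lt
      hlt).exists
  rw [Set.mem_Ico, div_le_iff₀ hW, lt_div_iff₀ hW, weightedIndex]
  constructor
  · rintro rfl
    refine ⟨?_, Nat.sInf_mem hne⟩
    by_contra! hlt
    set k := sInf {n | u * ∑' i, w i < ∑ i ∈ Finset.range (n + 1), w i} with hk
    cases h : k with
    | zero =>
      rw [h, Finset.sum_range_zero] at hlt
      exact absurd (mul_nonneg hu.1 hW.le) hlt.not_ge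
    | succ j =>
      have : k ≤ j := Nat.sInf_le (by rw [h] at hlt; exact hlt)
      omega
  · rintro ⟨h1, h2⟩
    refine le_antisymm (Nat.sInf_le h2) ?_
    by_contra! hlt
    have hmem : u * ∑' i, w i < _ := Nat.sInf_mem hne
    exact absurd (hmem.trans_le (hmono (Nat.succ_le_of_lt hlt))) h1.not_gt

instance isProbabilityMeasure_restrict_Ico :
    IsProbabilityMeasure ((volume : Measure ℝ).restrict (Set.Ico 0 1)) :=
  ⟨by simp⟩

/-- Index `n` is drawn on an interval of length `w n / ∑' i, w i`, so the expected loss of the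
sampled expert is the weighted mean. -/
theorem integral_weightedIndex {w : ℕ → ℝ} (hw : ∀ i, 0 < w i) (hs : Summable w) {g : ℕ → ℝ}
    {D : ℝ} (hg : ∀ i, g i ∈ Set.Icc 0 D) :
    ∫ u in Set.Ico (0 : ℝ) 1, g (weightedIndex w u) = (∑' i, w i * g i) / ∑' i, w i := by
  have hW : 0 < ∑' i, w i := hs.tsum_pos (fun i => (hw i).le) 0 (hw 0)
  have hm : Measurable (weightedIndex w) :=
    measurable_weightedIndex (w := fun _ : ℝ => w) (fun i => measurable_const) (fun _ => hs)
      measurable_id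
  set μ := (volume : Measure ℝ).restrict (Set.Ico 0 1)
  have : IsProbabilityMeasure (μ.map (weightedIndex w)) :=
    Measure.isProbabilityMeasure_map hm.aemeasurable
  have hreal : ∀ n, (μ.map (weightedIndex w)).real {n} = w n / ∑' i, w i := by
    intro n
    have hset : weightedIndex w ⁻¹' {n} ∩ Set.Ico 0 1
        = Set.Ico ((∑ i ∈ Finset.range n, w i) / ∑' i, w i)
          ((∑ i ∈ Finset.range (n + 1), w i) / ∑' i, w i) := by
      ext u
      constructor
      · rintro ⟨h1, h2⟩
        exact (weightedIndex_eq_iff hw hs h2 n).1 h1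
      · intro h
        have h2 : u ∈ Set.Ico (0 : ℝ) 1 := by
          refine ⟨le_trans (div_nonneg (Finset.sum_nonneg fun i _ => (hw i).le) hW.le) h.1,
            h.2.trans_le ((div_le_one hW).2 (hs.sum_le_tsum _ fun i _ => (hw i).le))⟩
        exact ⟨(weightedIndex_eq_iff hw hs h2 n).2 h, h2⟩
    rw [map_measureReal_apply hm (measurableSet_singleton n),
      measureReal_restrict_apply (hm (measurableSet_singleton n)), hset, Real.volume_real_Ico_of_le,
      Finset.sum_range_succ]
    · ring
    · rw [Finset.sum_range_succ]
      exact div_le_div_of_nonneg_right (by linarith [hw n]) hW.le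
  have hint : Integrable g (μ.map (weightedIndex w)) :=
    Integrable.of_mem_Icc 0 D (measurable_of_countable g).aemeasurable (ae_of_all _ hg)
  rw [← integral_map hm.aemeasurable hint.aestronglyMeasurable, integral_countable hint,
    ← tsum_div_const]
  refine tsum_congr fun n => ?_
  rw [hreal, smul_eq_mul]
  ring

end Sampling

/-! ### Strong law via Hoeffding and Borel–Cantelli -/

section LawOfLargeNumbers

/-- A one-sided strong law of large numbers for independent, uniformly bounded random variables
that need not be identically distributed. -/
theorem ae_eventually_sum_sub_integral_le {α : Type*} [MeasurableSpace α] (ν : Measure α)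
    [IsProbabilityMeasure ν] {g : ℕ → α → ℝ} (hg : ∀ t, Measurable (g t)) {D : ℝ}
    (hb : ∀ t u, g t u ∈ Set.Icc 0 D) {ε : ℝ} (hε : 0 < ε) :
    ∀ᵐ r ∂(Measure.infinitePi fun _ : ℕ => ν), ∀ᶠ T : ℕ in atTop,
      ∑ t ∈ Finset.range T, (g t (r t) - ∫ u, g t u ∂ν) ≤ ε * T := by
  set μ := Measure.infinitePi fun _ : ℕ => ν
  have hD : 0 ≤ D := by
    obtain ⟨u⟩ := nonempty_of_isProbabilityMeasure ν
    exact (hb 0 u).1.trans (hb 0 u).2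
  -- Hoeffding's variance proxy for the interval `[0, D + 1]`, enlarged so that `c > 0` even when `D
  -- = 0`.
  let c : NNReal := (‖(D + 1) - 0‖₊ / 2) ^ 2
  have hc : 0 < (c : ℝ) := by
    have : ‖(D + 1) - 0‖₊ ≠ 0 := by rw [Ne, nnnorm_eq_zero]; linarith
    have : 0 < ‖(D + 1) - 0‖₊ := pos_iff_ne_zero.2 this
    have h : 0 < c := by positivity
    exact_mod_cast h
  have hmean : ∀ t, ∫ r, g t (r t) ∂μ = ∫ u, g t u ∂ν := fun t => by
    have h := measurePreserving_eval_infinitePi (fun _ : ℕ => ν) t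
    rw [← h.map_eq, integral_map h.aemeasurable (hg t).aestronglyMeasurable]
  have hindep : iIndepFun (fun t (r : ℕ → α) => g t (r t) - ∫ u, g t u ∂ν) μ :=
    iIndepFun_infinitePi fun t => (hg t).sub_const _
  have hsub : ∀ t, HasSubgaussianMGF (fun r => g t (r t) - ∫ u, g t u ∂ν) c μ := fun t => by
    rw [← hmean t]
    exact hasSubgaussianMGF_of_mem_Icc ((hg t).comp (measurable_pi_apply t)).aemeasurable
      (ae_of_all _ fun r => ⟨(hb t _).1, (hb t _).2.trans (by linarith)⟩)
  let s : ℕ → Set (ℕ → α) := fun T =>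
    {r | ε * T ≤ ∑ t ∈ Finset.range T, (g t (r t) - ∫ u, g t u ∂ν)}
  have hs : ∀ T, μ (s T) ≤ ENNReal.ofReal (Real.exp (T * (-(ε ^ 2 / (2 * c))))) := fun T => by
    rw [← ofReal_measureReal]
    refine ENNReal.ofReal_le_ofReal ((HasSubgaussianMGF.measure_sum_range_ge_le_of_iIndepFun hindep
      (fun t _ => hsub t) (by positivity)).trans_eq ?_)
    congr 1
    rcases eq_or_ne T 0 with rfl | hT
    · simp
    · have : (T : ℝ) ≠ 0 := by exact_mod_cast hT
      field_simp
  have hsummable : Summable fun T : ℕ => Real.exp (T * (-(ε ^ 2 / (2 * c)))) :=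
    Real.summable_exp_nat_mul_iff.2 (neg_neg_of_pos (by positivity))
  have hfin : ∑' T, μ (s T) ≠ ⊤ :=
    ne_top_of_le_ne_top hsummable.tsum_ofReal_ne_top (ENNReal.tsum_le_tsum hs)
  filter_upwards [ae_eventually_notMem hfin] with r hr
  filter_upwards [hr] with T hT
  exact (not_le.1 hT).le

end LawOfLargeNumbers

/-! ### Sublinearity of the regret bound -/

section Rates

/-- The learning rates of the forecaster. -/
noncomputable def learningRate (t : ℕ) : ℝ := 1 / √((t : ℝ) + 1)

theorem learningRate_pos (t : ℕ) : 0 < learningRate t := by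
  unfold learningRate; positivity

theorem antitone_learningRate : Antitone learningRate := fun s t hst => by
  unfold learningRate
  have : (s : ℝ) ≤ t := by exact_mod_cast hst
  gcongr

theorem tendsto_learningRate : Tendsto learningRate atTop (nhds 0) := by
  have h : Tendsto (fun t : ℕ => (t : ℝ) + 1) atTop atTop :=
    tendsto_atTop_add_const_right _ _ tendsto_natCast_atTop_atTop
  exact (tendsto_const_nhds (x := (1 : ℝ))).div_atTop (Real.tendsto_sqrt_atTop.comp h)

theorem inv_mul_one_div_learningRate_le {T : ℕ} (hT : 1 ≤ T) :
    (T : ℝ)⁻¹ * (1 / learningRate T) ≤ 2 * learningRate T := by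
  have h1 : (1 : ℝ) ≤ T := by exact_mod_cast hT
  have hs : 0 < √((T : ℝ) + 1) := by positivity
  have hsq : √((T : ℝ) + 1) * √((T : ℝ) + 1) = T + 1 := Real.mul_self_sqrt (by positivity)
  unfold learningRate
  rw [one_div_one_div, inv_mul_le_iff₀ (by linarith)]
  rw [show (T : ℝ) * (2 * (1 / √((T : ℝ) + 1))) = 2 * T / √((T : ℝ) + 1) by ring,
    le_div_iff₀ hs, hsq]
  linarith

theorem eventually_regret_bound_le (a b : ℝ) {ε : ℝ} (hε : 0 < ε) :
    ∀ᶠ T : ℕ in atTop,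
      a / learningRate T + b * ∑ t ∈ Finset.range T, learningRate t ≤ ε * T := by
  have h1 : Tendsto (fun T : ℕ => (T : ℝ)⁻¹ * (1 / learningRate T)) atTop (nhds 0) := by
    refine tendsto_of_tendsto_of_tendsto_of_le_of_le' tendsto_const_nhds
      (by simpa using tendsto_learningRate.const_mul 2)
      (Eventually.of_forall fun T => ?_) ?_
    · have := (learningRate_pos T).le
      positivity
    · filter_upwards [eventually_ge_atTop 1] with T hT
      exact inv_mul_one_div_learningRate_le hT
  have h2 := (h1.const_mul a).add (tendsto_learningRate.cesaro.const_mul b)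
  rw [mul_zero, mul_zero, add_zero] at h2
  filter_upwards [h2.eventually_lt_const hε, eventually_ge_atTop 1] with T hT hT1
  have hT0 : (0 : ℝ) < T := by exact_mod_cast hT1
  calc _ = (a * ((T : ℝ)⁻¹ * (1 / learningRate T))
        + b * ((T : ℝ)⁻¹ * ∑ t ∈ Finset.range T, learningRate t)) * T := by
        field_simp
    _ ≤ ε * T := mul_le_mul_of_nonneg_right hT.le hT0.le

end Rates

/-! ### Upper limits of averages -/

section Averages

/-- The real `limsup` is an infimum of eventual upper bounds; the lower bound `-D` keeps that set
bounded below. -/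
theorem limsup_average_nonpos {a : ℕ → ℝ} {D : ℝ} (hD : ∀ t, -D ≤ a t)
    (h : ∀ ε : ℝ, 0 < ε → ∀ᶠ T : ℕ in atTop, ∑ t ∈ Finset.range T, a t ≤ ε * T) :
    limsup (fun T : ℕ => (1 / (T : ℝ)) * ∑ t ∈ Finset.range T, a t) atTop ≤ 0 := by
  refine le_of_forall_pos_le_add fun ε hε => ?_
  rw [zero_add]
  have hbdd : ∀ᶠ T : ℕ in atTop, -D ≤ (1 / (T : ℝ)) * ∑ t ∈ Finset.range T, a t := by
    filter_upwards [eventually_ge_atTop 1] with T hT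
    have hT0 : (0 : ℝ) < T := by exact_mod_cast hT
    have := Finset.sum_le_sum fun t (_ : t ∈ Finset.range T) => hD t
    rw [Finset.sum_const, Finset.card_range, nsmul_eq_mul] at this
    rw [one_div, le_inv_mul_iff₀ hT0]
    exact this
  refine limsup_le_of_le (IsBoundedUnder.isCoboundedUnder_le ⟨-D, hbdd⟩) ?_
  filter_upwards [h ε hε, eventually_ge_atTop 1] with T hT hT1
  have hT0 : (0 : ℝ) < T := by exact_mod_cast hT1
  rw [one_div, inv_mul_le_iff₀ hT0, mul_comm]
  exact hT

end Averages

/-! ### The learning rule and its regret -/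

section Rule

/-- The prior on the experts. -/
noncomputable def geometricPrior (i : ℕ) : ℝ := 1 / 2 / 2 ^ i

theorem geometricPrior_pos (i : ℕ) : 0 < geometricPrior i := by
  unfold geometricPrior; positivity

theorem hasSum_geometricPrior : HasSum geometricPrior 1 := hasSum_geometric_two' 1

variable {𝒳 : Type u} {𝒴 : Type v} [MetricSpace 𝒴]

/-- The exponential weight of the expert `F i` after `t` observations. -/
noncomputable def expertWeight (F : ℕ → 𝒳 → 𝒴) (t : ℕ) (x : Fin t → 𝒳) (y : Fin t → 𝒴)
    (i : ℕ) : ℝ :=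
  geometricPrior i * Real.exp (-(learningRate t * ∑ s, dist (F i (x s)) (y s)))

theorem expertWeight_pos (F : ℕ → 𝒳 → 𝒴) (t : ℕ) (x : Fin t → 𝒳) (y : Fin t → 𝒴) (i : ℕ) :
    0 < expertWeight F t x y i :=
  mul_pos (geometricPrior_pos i) (Real.exp_pos _)

theorem summable_expertWeight (F : ℕ → 𝒳 → 𝒴) (t : ℕ) (x : Fin t → 𝒳) (y : Fin t → 𝒴) :
    Summable (expertWeight F t x y) :=
  summable_expWeight geometricPrior_pos hasSum_geometricPrior.summable (learningRate_pos t).le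
    fun _ => Finset.sum_nonneg fun _ _ => dist_nonneg

variable [MeasurableSpace 𝒳] [TopologicalSpace.SeparableSpace 𝒴] [MeasurableSpace 𝒴]
  [BorelSpace 𝒴]

theorem measurable_expertPrediction {F : ℕ → 𝒳 → 𝒴} (hF : ∀ i, Measurable (F i)) (t : ℕ) :
    Measurable fun z : (ℕ → ℝ) × (Fin t → 𝒳) × (Fin t → 𝒴) × 𝒳 =>
      F (weightedIndex (expertWeight F t z.2.1 z.2.2.1) (z.1 t)) z.2.2.2 := by
  have := UniformSpace.secondCountable_of_separable 𝒴
  have hFm : Measurable fun p : ℕ × 𝒳 => F p.1 p.2 := measurable_from_prod_countable_right hF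
  refine hFm.comp (Measurable.prodMk (measurable_weightedIndex (fun i => ?_)
    (fun z => summable_expertWeight F t _ _) ?_) (by fun_prop))
  · refine measurable_const.mul (Real.measurable_exp.comp (Measurable.neg
      (measurable_const.mul (Finset.measurable_sum _ fun s _ => Measurable.dist ?_ ?_))))
    · exact (hF i).comp (by fun_prop)
    · fun_prop
  · fun_prop

/-- The rule that, at each time, follows an expert sampled from the exponential weights. -/
noncomputable def expWeightRule (F : ℕ → 𝒳 → 𝒴) (hF : ∀ i, Measurable (F i)) :
    OnlineLearningRule 𝒳 𝒴 where
  Seed := ℕ → ℝ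
  seedMeasurableSpace := inferInstance
  seedLaw := Measure.infinitePi fun _ => (volume : Measure ℝ).restrict (Set.Ico 0 1)
  isProbabilityMeasure_seedLaw := inferInstance
  predict t r x y x' := F (weightedIndex (expertWeight F t x y) (r t)) x'
  measurable_predict := measurable_expertPrediction hF

/-- For every fixed data sequence, almost surely the rule has asymptotically no regret with respect
to each of the experts. -/
theorem ae_forall_eventually_expWeightRule_le [BoundedSpace 𝒴] {F : ℕ → 𝒳 → 𝒴}
    (hF : ∀ i, Measurable (F i)) (x : ℕ → 𝒳) (y : ℕ → 𝒴) {ε : ℝ} (hε : 0 < ε) :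
    ∀ᵐ r ∂(expWeightRule F hF).seedLaw, ∀ i, ∀ᶠ T : ℕ in atTop,
      ∑ t ∈ Finset.range T, dist ((expWeightRule F hF).predict t r (fun s => x s)
        (fun s => y s) (x t)) (y t)
      ≤ ∑ t ∈ Finset.range T, dist (F i (x t)) (y t) + ε * T := by
  set D := Metric.diam (Set.univ : Set 𝒴)
  let ℓ : ℕ → ℕ → ℝ := fun t i => dist (F i (x t)) (y t)
  have hℓ : ∀ t i, ℓ t i ∈ Set.Icc 0 D := fun t i => ⟨dist_nonneg, dist_le_diam_univ _ _⟩
  let W : ℕ → ℕ → ℝ := fun t => expertWeight F t (fun s => x s) (fun s => y s)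
  -- With the data frozen, the weights do not depend on the seed, so the loss at time `t` uses only
  -- the coordinate `r t` and the losses are independent.
  let g : ℕ → ℝ → ℝ := fun t u => ℓ t (weightedIndex (W t) u)
  have hg : ∀ t, Measurable (g t) := fun t =>
    (measurable_of_countable (ℓ t)).comp (measurable_weightedIndex (w := fun _ => W t)
      (fun _ => measurable_const) (fun _ => summable_expertWeight F t _ _) measurable_id)
  have hmean : ∀ t, ∫ u in Set.Ico (0 : ℝ) 1, g t u = expWeightMean geometricPrior
      (learningRate t) (fun j => ∑ s ∈ Finset.range t, ℓ s j) (ℓ t) := fun t => by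
    refine (integral_weightedIndex (expertWeight_pos F t _ _) (summable_expertWeight F t _ _)
      (hℓ t)).trans ?_
    simp only [expertWeight, expWeightMean, expWeightSum, ℓ, Finset.sum_range]
  have hslln := ae_eventually_sum_sub_integral_le ((volume : Measure ℝ).restrict (Set.Ico 0 1)) hg
    (fun t u => hℓ t _) (half_pos hε)
  filter_upwards [hslln] with r hr i
  filter_upwards [hr, eventually_regret_bound_le (-Real.log (geometricPrior i)) (D ^ 2 / 2)
    (half_pos hε)] with T h1 h2
  have h3 := sum_expWeightMean_le geometricPrior_pos hasSum_geometricPrior learningRate_pos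
    antitone_learningRate hℓ i T
  rw [Finset.sum_sub_distrib] at h1
  simp only [hmean] at h1
  rw [neg_div] at h2
  have h4 : ∑ t ∈ Finset.range T, dist ((expWeightRule F hF).predict t r (fun s => x s)
        (fun s => y s) (x t)) (y t) = ∑ t ∈ Finset.range T, g t (r t) := rfl
  have h5 : ∑ t ∈ Finset.range T, dist (F i (x t)) (y t) = ∑ t ∈ Finset.range T, ℓ t i := rfl
  rw [h4, h5]
  linarith

end Rule

/-! ### Consistency under stationarity -/

section Consistency

variable {𝒳 : Type u} {𝒴 : Type v} [MeasurableSpace 𝒳] [MetricSpace 𝒴]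
  [TopologicalSpace.SeparableSpace 𝒴] [MeasurableSpace 𝒴] [BorelSpace 𝒴]

theorem OnlineLearningRule.measurable_excessLoss (f : OnlineLearningRule 𝒳 𝒴)
    (p : DataProcess.{u, v, w} 𝒳 𝒴) {f₀ : 𝒳 → 𝒴} (hf₀ : Measurable f₀) :
    Measurable fun z : p.Ω × f.Seed =>
      f.excessLoss f₀ z.2 (fun t => p.X t z.1) (fun t => p.Y t z.1) := by
  have := UniformSpace.secondCountable_of_separable 𝒴
  have hX : ∀ t, Measurable fun z : p.Ω × f.Seed => p.X t z.1 := fun t =>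
    (p.measurable_X t).comp measurable_fst
  have hY : ∀ t, Measurable fun z : p.Ω × f.Seed => p.Y t z.1 := fun t =>
    (p.measurable_Y t).comp measurable_fst
  refine Measurable.limsup fun T => measurable_const.mul (Finset.measurable_sum _ fun t _ =>
    Measurable.sub (Measurable.dist ?_ (hY t)) ((hf₀.comp (hX t)).dist (hY t)))
  have hXs : Measurable fun (z : p.Ω × f.Seed) (s : Fin t) => p.X s z.1 :=
    measurable_pi_lambda _ fun s => hX s
  have hYs : Measurable fun (z : p.Ω × f.Seed) (s : Fin t) => p.Y s z.1 :=
    measurable_pi_lambda _ fun s => hY s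
  exact (f.measurable_predict t).comp (measurable_snd.prodMk (hXs.prodMk (hYs.prodMk (hX t))))

variable [BoundedSpace 𝒴]

/-- Along almost every path of a stationary process, every measurable function is approximated in
average, uniformly over time, by the members of a family that is dense in `L¹`. -/
theorem ae_exists_forall_sum_dist_le {Ω : Type w} [MeasurableSpace Ω] {P : Measure Ω}
    [IsProbabilityMeasure P] {X : ℕ → Ω → 𝒳} (hX : ∀ t, Measurable (X t))
    (hst : IsStationaryProcess X P) {F : ℕ → 𝒳 → 𝒴} (hF : ∀ i, Measurable (F i))
    {f : 𝒳 → 𝒴} (hf : Measurable f)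
    (hdense : ∀ ε : ℝ, 0 < ε → ∃ i, ∫ x, dist (F i x) (f x) ∂(P.map (X 0)) ≤ ε)
    {ε : ℝ} (hε : 0 < ε) :
    ∀ᵐ ω ∂P, ∃ i, ∀ T : ℕ, ∑ t ∈ Finset.range T, dist (F i (X t ω)) (f (X t ω)) ≤ ε * T := by
  have := UniformSpace.secondCountable_of_separable 𝒴
  have : IsProbabilityMeasure (P.map (X 0)) := Measure.isProbabilityMeasure_map (hX 0).aemeasurable
  rw [ae_iff]
  refine le_antisymm (ENNReal.le_of_forall_pos_le_add fun δ hδ _ => ?_) zero_le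
  -- Dividing by `ε` in the maximal inequality leaves exactly `δ`.
  obtain ⟨i, hi⟩ := hdense (δ * ε) (mul_pos hδ hε)
  calc _ ≤ P {ω | ∃ T : ℕ, ε * T < ∑ t ∈ Finset.range T, dist (F i (X t ω)) (f (X t ω))} := by
        refine measure_mono fun ω hω => ?_
        simp only [Set.mem_ofPred_eq, not_exists, not_forall, not_le] at hω ⊢
        exact hω i
    _ ≤ ENNReal.ofReal ((∫ x, dist (F i x) (f x) ∂(P.map (X 0))) / ε) :=
        measure_exists_lt_sum_le_of_identDistrib_shift hX (hst 1) ((hF i).dist hf)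
          (integrable_dist_of_measurable (hF i) hf) (fun x => dist_nonneg) hε
    _ ≤ 0 + δ := by
        rw [zero_add, ← ENNReal.ofReal_coe_nnreal]
        exact ENNReal.ofReal_le_ofReal ((div_le_iff₀ hε).2 hi)

theorem expWeightRule_stronglyUniversallyConsistent {F : ℕ → 𝒳 → 𝒴}
    (hF : ∀ i, Measurable (F i))
    (hdense : ∀ (μ : Measure 𝒳) [IsFiniteMeasure μ] (f : 𝒳 → 𝒴), Measurable f → ∀ ε : ℝ, 0 < ε →
      ∃ i, ∫ x, dist (F i x) (f x) ∂μ ≤ ε) :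
    (expWeightRule F hF).StronglyUniversallyConsistent
      {p : DataProcess.{u, v, w} 𝒳 𝒴 | IsStationaryProcess p.X p.P} := by
  intro p hp f₀ hf₀
  -- By Fubini the data path is fixed first; the regret bound then holds for almost every seed.
  -- Tolerances `1 / (n + 1)` keep the exceptional sets countable in number.
  refine (Measure.ae_prod_iff_ae_ae (measurableSet_le
    ((expWeightRule F hF).measurable_excessLoss p hf₀) measurable_const)).2 ?_
  have hpos : ∀ n : ℕ, (0 : ℝ) < 1 / (n + 1) := fun n => Nat.one_div_pos_of_nat
  have happrox := ae_all_iff.2 fun n : ℕ => ae_exists_forall_sum_dist_le p.measurable_X hp hF hf₀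
    (fun ε hε => hdense _ f₀ hf₀ ε hε) (hpos n)
  filter_upwards [happrox] with ω hω
  have hregret := ae_all_iff.2 fun n : ℕ => ae_forall_eventually_expWeightRule_le hF
    (fun t => p.X t ω) (fun t => p.Y t ω) (hpos n)
  filter_upwards [hregret] with r hr
  refine limsup_average_nonpos (D := Metric.diam (Set.univ : Set 𝒴)) (fun t => ?_) fun ε hε => ?_
  · have h1 := dist_le_diam_univ (f₀ (p.X t ω)) (p.Y t ω)
    have h2 : 0 ≤ dist ((expWeightRule F hF).predict t r (fun s => p.X s ω) (fun s => p.Y s ω)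
      (p.X t ω)) (p.Y t ω) := dist_nonneg
    linarith
  · obtain ⟨n, hn⟩ := exists_nat_one_div_lt (half_pos hε)
    obtain ⟨i, hi⟩ := hω n
    filter_upwards [hr n i] with T hT
    have h1 : ∑ t ∈ Finset.range T, dist (F i (p.X t ω)) (p.Y t ω)
        ≤ ∑ t ∈ Finset.range T, dist (F i (p.X t ω)) (f₀ (p.X t ω))
          + ∑ t ∈ Finset.range T, dist (f₀ (p.X t ω)) (p.Y t ω) := by
      rw [← Finset.sum_add_distrib]
      exact Finset.sum_le_sum fun t _ => dist_triangle _ _ _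
    have h2 : 1 / ((n : ℝ) + 1) * T ≤ ε / 2 * T :=
      mul_le_mul_of_nonneg_right hn.le (Nat.cast_nonneg T)
    have h3 := hi T
    rw [Finset.sum_sub_distrib]
    linarith

end Consistency

theorem corollary2 (𝒳 : Type u) (𝒴 : Type v)
    [Nonempty 𝒳] [TopologicalSpace 𝒳] [TopologicalSpace.SeparableSpace 𝒳]
    [TopologicalSpace.MetrizableSpace 𝒳] [MeasurableSpace 𝒳] [BorelSpace 𝒳]
    [Nonempty 𝒴] [MetricSpace 𝒴] [BoundedSpace 𝒴] [TopologicalSpace.SeparableSpace 𝒴]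
    [MeasurableSpace 𝒴] [BorelSpace 𝒴] :
    ∃ f : OnlineLearningRule 𝒳 𝒴,
      f.StronglyUniversallyConsistent
        {p : DataProcess.{u, v, w} 𝒳 𝒴 | IsStationaryProcess p.X p.P} := by
  -- Second countability makes the Borel σ-algebra countably generated.
  have : SecondCountableTopology 𝒳 := by
    let := TopologicalSpace.metrizableSpaceMetric 𝒳
    exact UniformSpace.secondCountable_of_separable 𝒳
  obtain ⟨F, hF, hdense⟩ := exists_seq_measurable_dense_integral_dist 𝒳 𝒴
  exact ⟨expWeightRule F hF, expWeightRule_stronglyUniversallyConsistent hF hdense⟩
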